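/- **Schrijver's inequality.** Let $n\ge 0$ be an integer and let $A\in\mathbb{R}^{n\times n}$ be a doubly stochastic matrix, i.e. all entries of $A$ are nonnegative and every row sum and every column sum of $A$ equals $1$. Define $\tilde A\in\mathbb{R}^{n\times n}$ by $$\tilde A_{i,j}=A_{i,j}\,(1-A_{i,j})\qquad (1\le i,j\le n).$$ Then $$\operatorname{per}(\tilde A)\;\ge\;\prod_{i=1}^{n}\prod_{j=1}^{n}(1-A_{i,j}),$$ where $\operatorname{per}(M)=\sum_{\sigma\in S_n}\prod_{i=1}^n M_{i,\sigma(i)}$ denotes the permanent. -/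

import Mathlib

/-- For a square real matrix `A`, the matrix with entries `A i j * (1 - A i j)`. -/
def tildeMatrix {n : ℕ} (A : Matrix (Fin n) (Fin n) ℝ) : Matrix (Fin n) (Fin n) ℝ :=
  Matrix.of fun i j => A i j * (1 - A i j)

/-! Interpolate between a product of linear forms and a permanent. Give each edge `e` of the
complete bipartite graph variables `y e`, `z e`. With no edges processed, the polynomial is the
product over vertices of linear forms; weighted AM-GM with weights `A i j` bounds it below by a
constant times `∏ (y e * z e) ^ A e` (`prod_rpow_le_prod_sum`). Processing an edge replaces `a + b y
+ c z + d y z`, the dependence on its two variables, by `a + d`: the edge is unused or used by the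
matching. Since `b c ≤ a d` (`matchSum_correlation`), this costs at most a factor `α ^ α * (1 - α) ^
(1 - α)` with `α = A e` (`mul_rpow_le_add`). Once every edge is processed all vertex weights vanish,
only perfect matchings remain, and they sum to the permanent; the constants multiply to `∏ (1 - A i
j)`. -/

section MatchingSum

/-! ### Matching sums and their correlation inequalities -/

variable {V E : Type*} [DecidableEq V]

/-- The weighted sum over all matchings with edges from the list `l` of the (multi)graph in which
the edge `e` joins `f e` and `g e`, restricted to the vertex set `U`: a matching is weighted by the
product of the weights `w` of its edges and the weights `r` of the vertices it leaves uncovered. -/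
noncomputable def matchSum (f g : E → V) (w : E → ℝ) (r : V → ℝ) : List E → Finset V → ℝ
  | [], U => ∏ v ∈ U, r v
  | e :: l, U => matchSum f g w r l U +
      if f e ∈ U ∧ g e ∈ U then w e * matchSum f g w r l ((U.erase (f e)).erase (g e)) else 0

/-- The total weight of the edges in the list `l` joining `u` and `x`. -/
noncomputable def linkWeight (f g : E → V) (w : E → ℝ) (l : List E) (u x : V) : ℝ :=
  (l.map fun e => if (f e = u ∧ g e = x) ∨ (f e = x ∧ g e = u) then w e else 0).sum

variable {f g : E → V} {w : E → ℝ} {r : V → ℝ}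

theorem matchSum_nonneg (hw : ∀ e, 0 ≤ w e) (hr : ∀ v, 0 ≤ r v) (l : List E) (U : Finset V) :
    0 ≤ matchSum f g w r l U := by
  induction l generalizing U with
  | nil => exact Finset.prod_nonneg fun v _ => hr v
  | cons e l ih =>
    rw [matchSum]
    split_ifs
    · exact add_nonneg (ih _) (mul_nonneg (hw e) (ih _))
    · simpa using ih U

theorem linkWeight_nonneg (hw : ∀ e, 0 ≤ w e) (l : List E) (u x : V) :
    0 ≤ linkWeight f g w l u x := by
  refine List.sum_nonneg fun a ha => ?_
  obtain ⟨e, -, rfl⟩ := List.mem_map.1 ha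
  split_ifs
  exacts [hw e, le_rfl]

theorem linkWeight_cons (e : E) (l : List E) (u x : V) :
    linkWeight f g w (e :: l) u x =
      (if (f e = u ∧ g e = x) ∨ (f e = x ∧ g e = u) then w e else 0) + linkWeight f g w l u x := by
  simp [linkWeight]

theorem linkWeight_eq_zero {c : V → Bool} (hc : ∀ e, c (f e) ≠ c (g e)) (l : List E) {u x : V}
    (h : c u = c x) : linkWeight f g w l u x = 0 := by
  refine List.sum_eq_zero fun a ha => ?_
  obtain ⟨e, -, rfl⟩ := List.mem_map.1 ha
  rw [if_neg]
  rintro (⟨rfl, rfl⟩ | ⟨rfl, rfl⟩)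
  exacts [hc e h, hc e h.symm]

theorem matchSum_congr {r' : V → ℝ} (l : List E) {U : Finset V} (h : ∀ v ∈ U, r v = r' v) :
    matchSum f g w r l U = matchSum f g w r' l U := by
  induction l generalizing U with
  | nil => exact Finset.prod_congr rfl h
  | cons e l ih =>
    rw [matchSum, matchSum, ih h,
      ih fun v hv => h v (Finset.mem_of_mem_erase (Finset.mem_of_mem_erase hv))]

/-- Expansion of the matching sum along the vertex `u`. -/
theorem matchSum_expand (hfg : ∀ e, f e ≠ g e) (l : List E) {U : Finset V} {u : V} (hu : u ∈ U) :
    matchSum f g w r l U = r u * matchSum f g w r l (U.erase u) +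
      ∑ x ∈ U.erase u, linkWeight f g w l u x * matchSum f g w r l ((U.erase u).erase x) := by
  induction l generalizing U with
  | nil => simp [matchSum, linkWeight, Finset.mul_prod_erase _ _ hu]
  | cons e l ih =>
    by_cases h1 : f e = u
    · subst h1
      have hL : ∀ x, linkWeight f g w (e :: l) (f e) x =
          (if x = g e then w e else 0) + linkWeight f g w l (f e) x := by
        intro x
        rw [linkWeight_cons]
        congr 1
        refine if_congr ?_ rfl rfl
        have := (hfg e).symm
        simp [this, eq_comm]
      simp only [matchSum, hL, add_mul, Finset.sum_add_distrib, ite_mul, zero_mul,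
        Finset.sum_ite_eq', Finset.mem_erase, ne_eq, not_true_eq_false, false_and, if_false,
        and_false, add_zero]
      rw [ih hu]
      simp only [hu, (hfg e).symm, not_false_eq_true, true_and]
      ring
    by_cases h2 : g e = u
    · subst h2
      have hL : ∀ x, linkWeight f g w (e :: l) (g e) x =
          (if x = f e then w e else 0) + linkWeight f g w l (g e) x := by
        intro x
        rw [linkWeight_cons]
        congr 1
        refine if_congr ?_ rfl rfl
        simp [hfg e, eq_comm]
      simp only [matchSum, hL, add_mul, Finset.sum_add_distrib, ite_mul, zero_mul,
        Finset.sum_ite_eq', Finset.mem_erase, ne_eq, not_true_eq_false, false_and, if_false,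
        and_false, add_zero]
      rw [ih hu, Finset.erase_right_comm (a := f e)]
      simp only [hu, hfg e, not_false_eq_true, true_and, and_true]
      ring
    have hL : ∀ x, linkWeight f g w (e :: l) u x = linkWeight f g w l u x := by
      intro x
      simp [linkWeight_cons, h1, h2]
    simp only [matchSum, hL, mul_add, Finset.sum_add_distrib]
    rw [ih hu]
    by_cases h : f e ∈ U ∧ g e ∈ U
    · have hu' : u ∈ (U.erase (f e)).erase (g e) := by
        simp [hu, Ne.symm h1, Ne.symm h2]
      rw [if_pos h, ih hu', if_pos (by simp [h1, h2, h])]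
      have hs : ∑ x ∈ U.erase u, linkWeight f g w l u x *
          (if f e ∈ (U.erase u).erase x ∧ g e ∈ (U.erase u).erase x then
            w e * matchSum f g w r l ((((U.erase u).erase x).erase (f e)).erase (g e)) else 0) =
          ∑ x ∈ ((U.erase (f e)).erase (g e)).erase u, w e * (linkWeight f g w l u x *
            matchSum f g w r l ((((U.erase (f e)).erase (g e)).erase u).erase x)) := by
        symm
        -- If `x` is an endpoint of `e`, then `e` is unavailable once `x` is deleted, so only the
        -- other `x` contribute.
        refine Finset.sum_subset_zero_on_sdiff (fun x hx => ?_) (fun x hx => ?_) (fun x hx => ?_)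
        · simp only [Finset.mem_erase] at hx ⊢
          tauto
        · simp only [Finset.mem_sdiff, Finset.mem_erase] at hx
          rw [if_neg, mul_zero]
          simp only [Finset.mem_erase]
          rintro ⟨⟨ha, -⟩, hb, -⟩
          exact hx.2 ⟨hx.1.1, Ne.symm hb, Ne.symm ha, hx.1.2⟩
        · simp only [Finset.mem_erase] at hx
          rw [if_pos (by simp [h1, h2, h, Ne.symm hx.2.1, Ne.symm hx.2.2.1])]
          have : (((U.erase u).erase x).erase (f e)).erase (g e) =
              (((U.erase (f e)).erase (g e)).erase u).erase x := by
            ext a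
            simp only [Finset.mem_erase]
            tauto
          rw [this]
          ring
      have he : ((U.erase u).erase (f e)).erase (g e) =
          ((U.erase (f e)).erase (g e)).erase u := by
        ext a
        simp only [Finset.mem_erase]
        tauto
      rw [hs, he, ← Finset.mul_sum]
      ring
    · rw [if_neg h, if_neg (by simp only [Finset.mem_erase]; tauto)]
      rw [Finset.sum_eq_zero (s := U.erase u) (f := fun x => linkWeight f g w l u x * ite _ _ _)]
      · ring
      · intro x _
        rw [if_neg (by simp only [Finset.mem_erase]; tauto), mul_zero]

/-- The matching sum is affine in the weight of each vertex. -/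
theorem matchSum_update_add (hfg : ∀ e, f e ≠ g e) (l : List E) {U : Finset V} {u : V}
    (hu : u ∈ U) (t : ℝ) :
    matchSum f g w (Function.update r u (r u + t)) l U =
      matchSum f g w r l U + t * matchSum f g w r l (U.erase u) := by
  have h : ∀ W : Finset V, u ∉ W →
      matchSum f g w (Function.update r u (r u + t)) l W = matchSum f g w r l W := by
    refine fun W hW => matchSum_congr l fun v hv => Function.update_of_ne ?_ _ _
    rintro rfl
    exact hW hv
  rw [matchSum_expand hfg l hu, matchSum_expand hfg l hu, h _ (by simp)]
  simp only [h _ (show u ∉ (U.erase u).erase _ by simp), Function.update_self]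
  ring

/-- In a bipartite graph, deleting vertices of the same colour is negatively correlated and
deleting vertices of opposite colours is positively correlated. -/
theorem matchSum_correlation {c : V → Bool} (hc : ∀ e, c (f e) ≠ c (g e)) (hw : ∀ e, 0 ≤ w e)
    (l : List E) (k : ℕ) : ∀ (U : Finset V), U.card = k → ∀ u ∈ U, ∀ v ∈ U, u ≠ v →
      (c u = c v → matchSum f g w r l U * matchSum f g w r l ((U.erase u).erase v) ≤
        matchSum f g w r l (U.erase u) * matchSum f g w r l (U.erase v)) ∧
      (c u ≠ c v → matchSum f g w r l (U.erase u) * matchSum f g w r l (U.erase v) ≤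
        matchSum f g w r l U * matchSum f g w r l ((U.erase u).erase v)) := by
  have hfg : ∀ e, f e ≠ g e := fun e h => hc e (congrArg c h)
  induction k with
  | zero =>
    intro U hU u hu
    simp [Finset.card_eq_zero.1 hU] at hu
  | succ k ih =>
    intro U hU u hu v hv huv
    have hv' : v ∈ U.erase u := Finset.mem_erase.2 ⟨huv.symm, hv⟩
    have hk : (U.erase u).card = k := by rw [Finset.card_erase_of_mem hu, hU]; rfl
    have hE := matchSum_expand (w := w) (r := r) hfg l hu
    rw [← Finset.add_sum_erase _ _ hv'] at hE
    have hE' := matchSum_expand (w := w) (r := r) hfg l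
      (show u ∈ U.erase v from Finset.mem_erase.2 ⟨huv, hu⟩)
    rw [Finset.erase_right_comm (a := v)] at hE'
    -- Expand `U` and `U.erase v` along `u`. The `r u` terms cancel, `x = v` gives the square, and
    -- every other `x` leaves the same kind of difference for `v, x` in `U.erase u`. Only `x`
    -- coloured unlike `u` matter, so the two sign cases alternate in the induction.
    have key : matchSum f g w r l U * matchSum f g w r l ((U.erase u).erase v) -
        matchSum f g w r l (U.erase u) * matchSum f g w r l (U.erase v) =
        linkWeight f g w l u v * matchSum f g w r l ((U.erase u).erase v) ^ 2 +
        ∑ x ∈ (U.erase u).erase v, linkWeight f g w l u x *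
          (matchSum f g w r l ((U.erase u).erase x) * matchSum f g w r l ((U.erase u).erase v) -
          matchSum f g w r l (U.erase u) * matchSum f g w r l (((U.erase u).erase v).erase x)) := by
      simp only [mul_sub, Finset.sum_sub_distrib]
      rw [hE, hE']
      simp only [mul_add, add_mul, Finset.sum_mul, Finset.mul_sum]
      simp only [mul_assoc, mul_left_comm]
      ring
    refine ⟨fun h => ?_, fun h => ?_⟩
    · rw [← sub_nonpos, key, linkWeight_eq_zero hc l h, zero_mul, zero_add]
      refine Finset.sum_nonpos fun x hx => ?_
      by_cases hx' : c u = c x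
      · rw [linkWeight_eq_zero hc l hx', zero_mul]
      · have := (ih _ hk v hv' x (Finset.mem_of_mem_erase hx) (Finset.ne_of_mem_erase hx).symm).2
          (h ▸ hx')
        exact mul_nonpos_of_nonneg_of_nonpos (linkWeight_nonneg hw l u x) (by linarith)
    · rw [← sub_nonneg, key]
      refine add_nonneg (mul_nonneg (linkWeight_nonneg hw l u v) (sq_nonneg _))
        (Finset.sum_nonneg fun x hx => ?_)
      by_cases hx' : c u = c x
      · rw [linkWeight_eq_zero hc l hx', zero_mul]
      · have hvx : c v = c x := by
          revert h hx'; cases c u <;> cases c v <;> cases c x <;> simp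
        have := (ih _ hk v hv' x (Finset.mem_of_mem_erase hx) (Finset.ne_of_mem_erase hx).symm).1
          hvx
        exact mul_nonneg (linkWeight_nonneg hw l u x) (by linarith)

end MatchingSum

/-! ### Capacity of a bilinear polynomial -/

section OneVariable

open Real

/-- Evaluate `hK` at one good point to bound `K`, then compare with `a + d` by AM-GM with weights `1
- α` and `α` on `a / (1 - α)` and `d / α`. -/
theorem mul_rpow_le_add_of_pos {a b c d K α : ℝ} (ha : 0 < a) (hb : 0 < b) (hd : 0 < d)
    (h : b * c ≤ a * d) (hα : 0 < α) (hα' : α < 1)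
    (hK : ∀ y z : ℝ, 0 < y → 0 < z → K * (y * z) ^ α ≤ a + b * y + c * z + d * (y * z)) :
    K * (α ^ α * (1 - α) ^ (1 - α)) ≤ a + d := by
  have hβ : 0 < 1 - α := by linarith
  set β := 1 - α with hβdef
  -- With `c` raised to `a d / b` the polynomial factors as `a (1 + b y / a) (1 + d z / b)`, and `(1
  -- + t) / t ^ α` is least at `t = α / β`; this point makes both `t` optimal, where the value is `a
  -- / β ^ 2`.
  have h1 := hK (α / β * (a / b)) (α / β * (b / d)) (by positivity) (by positivity)
  have hc : c * (α / β * (b / d)) ≤ α / β * a := by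
    have : c * (α / β * (b / d)) = α / β * (b * c / d) := by ring
    rw [this]
    refine mul_le_mul_of_nonneg_left ?_ (by positivity)
    rwa [div_le_iff₀ hd]
  have h2 : K * ((α / β) ^ 2 * (a / d)) ^ α ≤ a / β ^ 2 := by
    have e1 : α / β * (a / b) * (α / β * (b / d)) = (α / β) ^ 2 * (a / d) := by
      field_simp
    rw [e1] at h1
    have e2 : b * (α / β * (a / b)) = α / β * a := by field_simp
    have e3 : d * ((α / β) ^ 2 * (a / d)) = (α / β) ^ 2 * a := by field_simp
    rw [e2, e3] at h1
    refine h1.trans ?_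
    have : a / β ^ 2 = a + α / β * a + α / β * a + (α / β) ^ 2 * a := by
      field_simp
      rw [hβdef]; ring
    linarith
  have h3 := geom_mean_le_arith_mean2_weighted hβ.le hα.le (div_nonneg ha.le hβ.le)
    (div_nonneg hd.le hα.le) (by rw [hβdef]; ring)
  have e4 : β * (a / β) + α * (d / α) = a + d := by field_simp
  rw [e4] at h3
  refine le_trans ?_ h3
  have hp : 0 < ((α / β) ^ 2 * (a / d)) ^ α := by positivity
  rw [← le_div_iff₀ hp] at h2
  refine (mul_le_mul_of_nonneg_right h2 (by positivity)).trans (le_of_eq ?_)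
  have hpow : ∀ x : ℝ, 0 < x → x ^ β = x / x ^ α := fun x hx => by
    rw [hβdef, rpow_sub hx, rpow_one]
  rw [hpow _ hβ, hpow _ (by positivity), mul_rpow (by positivity) (by positivity),
    div_rpow ha.le hd.le, div_rpow ha.le hβ.le, div_rpow hd.le hα.le,
    div_pow, div_rpow (by positivity) (by positivity), sq α, sq β, mul_rpow hα.le hα.le,
    mul_rpow hβ.le hβ.le]
  field_simp

/-- Let `t → 0⁺`. This serves the endpoint exponents `α = 0` (with `y = z = t`) and `α = 1` (with `y
= z = t⁻¹`, after multiplying by `t ^ 2`). -/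
theorem le_of_forall_pos_le_add_mul_add_sq {a b d K : ℝ}
    (hK : ∀ t : ℝ, 0 < t → K ≤ a + b * t + d * t ^ 2) : K ≤ a := by
  have h : Filter.Tendsto (fun t : ℝ => a + b * t + d * t ^ 2) (nhdsWithin 0 (Set.Ioi 0))
      (nhds a) := by
    have : Continuous fun t : ℝ => a + b * t + d * t ^ 2 := by fun_prop
    simpa using (this.tendsto 0).mono_left nhdsWithin_le_nhds
  exact ge_of_tendsto h (Filter.eventually_of_mem self_mem_nhdsWithin fun t ht => hK t ht)

/-- A capacity bound for bilinear polynomials with nonnegative coefficients and `b c ≤ a d`. -/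
theorem mul_rpow_le_add {a b c d K α : ℝ} (ha : 0 ≤ a) (hb : 0 ≤ b) (hc : 0 ≤ c) (hd : 0 ≤ d)
    (h : b * c ≤ a * d) (hα : 0 ≤ α) (hα' : α ≤ 1)
    (hK : ∀ y z : ℝ, 0 < y → 0 < z → K * (y * z) ^ α ≤ a + b * y + c * z + d * (y * z)) :
    K * (α ^ α * (1 - α) ^ (1 - α)) ≤ a + d := by
  rcases hα.eq_or_lt with rfl | hα
  · have : K ≤ a := le_of_forall_pos_le_add_mul_add_sq (b := b + c) (d := d) fun t ht => by
      have := hK t t ht ht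
      rw [rpow_zero] at this
      linarith
    simp
    linarith
  rcases hα'.eq_or_lt with rfl | hα'
  · have : K ≤ d := le_of_forall_pos_le_add_mul_add_sq (b := b + c) (d := a) fun t ht => by
      have := hK t⁻¹ t⁻¹ (by positivity) (by positivity)
      rw [rpow_one] at this
      have h2 := mul_le_mul_of_nonneg_right this (sq_nonneg t)
      field_simp at h2
      linarith
    simp
    linarith
  -- Perturb `a`, `b`, `d` to be positive. The increment of `b` is `η ^ 2 / (c + 1)` so that its
  -- product with `c` stays below the `η ^ 2` gained in `(a + η) * (d + η)`.
  refine le_of_forall_pos_le_add fun ε hε => ?_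
  have hη : 0 < ε / 2 := by positivity
  set η := ε / 2 with hηdef
  have h1 : K * (α ^ α * (1 - α) ^ (1 - α)) ≤ (a + η) + (d + η) := by
    refine mul_rpow_le_add_of_pos (b := b + η ^ 2 / (c + 1)) (c := c) (by positivity)
      (by positivity) (by positivity) ?_ hα hα' fun y z hy hz => (hK y z hy hz).trans ?_
    · have : η ^ 2 / (c + 1) * c ≤ η ^ 2 := by
        rw [div_mul_eq_mul_div, div_le_iff₀ (by positivity)]
        nlinarith [sq_nonneg η]
      nlinarith [mul_nonneg ha hη.le, mul_nonneg hd hη.le]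
    · have h2 : 0 ≤ η ^ 2 / (c + 1) * y := by positivity
      have h3 : 0 ≤ η * (y * z) := by positivity
      nlinarith
  linarith

end OneVariable

/-! ### The bipartite graph of a matrix -/

section Schrijver

variable {ι : Type*}

theorem isLeft_inl_ne_isLeft_inr (e : ι × ι) :
    Sum.isLeft (Sum.inl e.1 : ι ⊕ ι) ≠ Sum.isLeft (Sum.inr e.2 : ι ⊕ ι) := by simp

variable [DecidableEq ι]

/-- The matching sum of the complete bipartite graph on two copies of `ι`. -/
noncomputable abbrev bipartiteMatchSum (w : ι × ι → ℝ) (r : ι ⊕ ι → ℝ) (l : List (ι × ι)) :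
    Finset (ι ⊕ ι) → ℝ :=
  matchSum (fun e => Sum.inl e.1) (fun e => Sum.inr e.2) w r l

/-- The vertex weights coming from the edges in `S`: an edge `e` contributes `y e` to its left
endpoint and `z e` to its right endpoint. -/
noncomputable def vertexWeight (S : Finset (ι × ι)) (y z : ι × ι → ℝ) : ι ⊕ ι → ℝ :=
  Sum.elim (fun i => ∑ e ∈ S with e.1 = i, y e) (fun j => ∑ e ∈ S with e.2 = j, z e)

theorem vertexWeight_nonneg {S : Finset (ι × ι)} {y z : ι × ι → ℝ} (hy : ∀ e, 0 ≤ y e)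
    (hz : ∀ e, 0 ≤ z e) (v : ι ⊕ ι) : 0 ≤ vertexWeight S y z v := by
  cases v
  exacts [Finset.sum_nonneg fun e _ => hy e, Finset.sum_nonneg fun e _ => hz e]

/-- In this form `matchSum_update_add` applies once per endpoint, exhibiting the matching sum as
bilinear in `y e` and `z e`. -/
theorem vertexWeight_insert {S : Finset (ι × ι)} {e : ι × ι} (he : e ∉ S) (y z : ι × ι → ℝ) :
    vertexWeight (insert e S) y z =
      Function.update (Function.update (vertexWeight S y z) (Sum.inl e.1)
        (vertexWeight S y z (Sum.inl e.1) + y e)) (Sum.inr e.2)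
        (vertexWeight S y z (Sum.inr e.2) + z e) := by
  ext (a | a)
  · rw [Function.update_of_ne (by simp), Function.update_apply]
    by_cases h : a = e.1
    · subst h
      rw [if_pos rfl]
      simp only [vertexWeight, Sum.elim_inl, Finset.filter_insert, if_true]
      rw [Finset.sum_insert (by simp [he]), add_comm]
    · rw [if_neg (by simpa using h)]
      simp only [vertexWeight, Sum.elim_inl, Finset.filter_insert, if_neg (Ne.symm h)]
  · rw [Function.update_apply]
    by_cases h : a = e.2
    · subst h
      rw [if_pos rfl]
      simp only [vertexWeight, Sum.elim_inr, Finset.filter_insert, if_true]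
      rw [Finset.sum_insert (by simp [he]), add_comm]
    · rw [if_neg (by simpa using h), Function.update_of_ne (by simp)]
      simp only [vertexWeight, Sum.elim_inr, Finset.filter_insert, if_neg (Ne.symm h)]

theorem vertexWeight_congr {S : Finset (ι × ι)} {y z y' z' : ι × ι → ℝ}
    (hy : ∀ e ∈ S, y e = y' e) (hz : ∀ e ∈ S, z e = z' e) :
    vertexWeight S y z = vertexWeight S y' z' := by
  ext (a | a)
  · exact Finset.sum_congr rfl fun e he => hy e (Finset.mem_of_mem_filter e he)
  · exact Finset.sum_congr rfl fun e he => hz e (Finset.mem_of_mem_filter e he)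

variable [Fintype ι]

/-! ### The permanent as a matching sum -/

theorem linkWeight_univ_inl_inr (w : ι × ι → ℝ) (i j : ι) :
    linkWeight (fun e : ι × ι => (Sum.inl e.1 : ι ⊕ ι)) (fun e => Sum.inr e.2) w
      Finset.univ.toList (Sum.inl i) (Sum.inr j) = w (i, j) := by
  rw [linkWeight, Finset.sum_map_toList, Finset.sum_eq_single (i, j)]
  · simp
  · rintro ⟨a, b⟩ - h
    rw [if_neg]
    simpa [Prod.ext_iff] using h
  · simp

/-- Zero vertex weights forbid uncovered vertices, so expansion along a left vertex becomes Laplace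
expansion of a permanent along a row. -/
theorem bipartiteMatchSum_univ_expand (w : ι × ι → ℝ) {I J : Finset ι} {i : ι} (hi : i ∈ I) :
    bipartiteMatchSum w 0 Finset.univ.toList (I.disjSum J) =
      ∑ j ∈ J, w (i, j) *
        bipartiteMatchSum w 0 Finset.univ.toList ((I.erase i).disjSum (J.erase j)) := by
  have h1 : (I.disjSum J).erase (Sum.inl i) = (I.erase i).disjSum J := by
    ext (a | a) <;> simp
  have h2 : ∀ j, ((I.erase i).disjSum J).erase (Sum.inr j) = (I.erase i).disjSum (J.erase j) := by
    intro j
    ext (a | a) <;> simp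
  rw [bipartiteMatchSum, matchSum_expand (fun e => by simp) _
    (show Sum.inl i ∈ I.disjSum J by simpa using hi), h1, Finset.sum_disjSum]
  rw [Finset.sum_eq_zero (s := I.erase i)]
  · simp only [Pi.zero_apply, zero_mul, zero_add, h2, linkWeight_univ_inl_inr]
  · intro a _
    rw [linkWeight_eq_zero (c := Sum.isLeft) (u := Sum.inl i) (x := Sum.inl a)
      isLeft_inl_ne_isLeft_inr _ rfl, zero_mul]

/-- Row expansion by induction on `I`. The reference permutation `τ` fixes the values off `I`, and
hence the columns `I.image τ` left for `I`; letting it vary lets the induction pin one more value.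
-/
theorem sum_perm_eq_bipartiteMatchSum (w : ι × ι → ℝ) (I : Finset ι) :
    ∀ τ : Equiv.Perm ι,
      ∑ σ : Equiv.Perm ι with ∀ i ∉ I, σ i = τ i, ∏ i ∈ I, w (i, σ i) =
        bipartiteMatchSum w 0 Finset.univ.toList (I.disjSum (I.image τ)) := by
  induction I using Finset.induction_on with
  | empty =>
    intro τ
    have h1 : (Finset.univ.filter fun σ : Equiv.Perm ι => ∀ i ∉ (∅ : Finset ι), σ i = τ i) =
        {τ} := by
      ext σ
      simp [Equiv.ext_iff]
    have h2 : ∀ l : List (ι × ι), bipartiteMatchSum w 0 l ∅ = 1 := by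
      intro l
      induction l with
      | nil => simp [matchSum]
      | cons e l ih => simpa [matchSum] using ih
    rw [h1]
    simp [h2]
  | insert u I hu ih =>
    intro τ
    rw [bipartiteMatchSum_univ_expand w (Finset.mem_insert_self u I), Finset.erase_insert hu]
    rw [← Finset.sum_fiberwise_of_maps_to (t := (insert u I).image τ) (g := fun σ => σ u)]
    · refine Finset.sum_congr rfl fun j hj => ?_
      obtain ⟨k, hk, rfl⟩ := Finset.mem_image.1 hj
      -- On the fibre `σ u = τ k` the new reference is `τ * Equiv.swap k u`, which sends `u` to `τ
      -- k` and agrees with `τ` off `insert u I`.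
      have hτ : ∀ i ∉ insert u I, (τ * Equiv.swap k u) i = τ i := by
        intro i hi
        rw [Equiv.Perm.mul_apply, Equiv.swap_apply_of_ne_of_ne]
        · rintro rfl; exact hi hk
        · rintro rfl; exact hi (Finset.mem_insert_self _ _)
      have hτu : (τ * Equiv.swap k u) u = τ k := by simp
      have him : I.image (τ * Equiv.swap k u) = ((insert u I).image τ).erase (τ k) := by
        have h0 : (insert u I).image (Equiv.swap k u) = insert u I := by
          refine Finset.eq_of_subset_of_card_le ?_ (by
            rw [Finset.card_image_of_injective _ (Equiv.injective _)])
          intro x hx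
          obtain ⟨y, hy, rfl⟩ := Finset.mem_image.1 hx
          rw [Equiv.swap_apply_def]
          split_ifs
          exacts [Finset.mem_insert_self _ _, hk, hy]
        rw [← hτu, ← h0, Finset.image_image, ← Equiv.Perm.coe_mul,
          ← Finset.image_erase (Equiv.injective _), Finset.erase_insert hu]
      rw [← him, ← ih, Finset.mul_sum, Finset.filter_filter]
      refine Finset.sum_congr ?_ fun σ hσ => ?_
      · ext σ
        simp only [Finset.mem_filter, Finset.mem_univ, true_and]
        constructor
        · rintro ⟨h, h'⟩ i hi
          by_cases hiu : i = u
          · rw [hiu, h', hτu]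
          · rw [h i (by simp [hi, hiu]), hτ i (by simp [hi, hiu])]
        · intro h
          refine ⟨fun i hi => ?_, by rw [h u hu, hτu]⟩
          rw [h i fun hi' => hi (Finset.mem_insert_of_mem hi'), hτ i hi]
      · rw [Finset.prod_insert hu, (Finset.mem_filter.1 hσ).2 u hu, hτu]
    -- If `σ u` lay outside the image, its `τ`-preimage would be a point off `insert u I` with the
    -- same `σ`-value as `u`, contradicting injectivity.
    · intro σ hσ
      have h := (Finset.mem_filter.1 hσ).2
      by_contra hn
      have : τ.symm (σ u) ∉ insert u I := fun hm =>
        hn (Finset.mem_image.2 ⟨_, hm, by simp⟩)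
      have h3 := h _ this
      rw [Equiv.apply_symm_apply] at h3
      rw [σ.injective h3] at this
      exact this (Finset.mem_insert_self u I)

theorem permanent_eq_bipartiteMatchSum (M : Matrix ι ι ℝ) :
    M.permanent = bipartiteMatchSum (fun e => M e.1 e.2) 0 Finset.univ.toList Finset.univ := by
  have h := sum_perm_eq_bipartiteMatchSum (fun e => M e.1 e.2) Finset.univ 1
  have h1 : (Finset.univ : Finset ι).disjSum (Finset.univ.image (1 : Equiv.Perm ι)) =
      Finset.univ := by
    ext (a | a) <;> simp
  rw [h1] at h
  rw [← h, ← Matrix.permanent_transpose]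
  simp [Matrix.permanent]

/-! ### Edge-by-edge induction on the capacity bound -/

open Real in
/-- Capacity bounds propagate along the addition of edges to the matching sum. -/
theorem capacity_le_bipartiteMatchSum {w α : ι × ι → ℝ} (hw : ∀ e, 0 ≤ w e) (hα : ∀ e, 0 ≤ α e)
    (hα' : ∀ e, α e ≤ 1) {K : ℝ}
    (hK : ∀ y z : ι × ι → ℝ, (∀ e, 0 < y e) → (∀ e, 0 < z e) →
      K * ∏ e, (y e * z e) ^ α e ≤
        ∏ v, vertexWeight Finset.univ (fun e => w e * y e) z v)
    (l : List (ι × ι)) (hl : l.Nodup) :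
    ∀ y z : ι × ι → ℝ, (∀ e, 0 < y e) → (∀ e, 0 < z e) →
      K * (∏ e ∈ l.toFinset, (α e ^ α e * (1 - α e) ^ (1 - α e))) *
          ∏ e ∈ l.toFinsetᶜ, (y e * z e) ^ α e ≤
        bipartiteMatchSum w (vertexWeight l.toFinsetᶜ (fun e => w e * y e) z) l
          Finset.univ := by
  induction l with
  | nil => simpa [matchSum] using hK
  | cons e l ih =>
    intro y z hy hz
    have hel : e ∉ l.toFinset := by simpa using (List.nodup_cons.1 hl).1
    set S := (e :: l).toFinsetᶜ with hS
    have heS : e ∉ S := by simp [hS]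
    have hlS : l.toFinsetᶜ = insert e S := by
      ext a
      by_cases h : a = e
      · subst h; simpa using hel
      · simp [hS, h]
    set r := vertexWeight S (fun e => w e * y e) z with hr
    have hr0 : ∀ v, 0 ≤ r v :=
      vertexWeight_nonneg (fun e => mul_nonneg (hw e) (hy e).le) fun e => (hz e).le
    have hne : ∀ e : ι × ι, (Sum.inl e.1 : ι ⊕ ι) ≠ Sum.inr e.2 := fun e => by simp
    set F := bipartiteMatchSum w r l with hF
    have hF0 : ∀ U, 0 ≤ F U := matchSum_nonneg hw hr0 l
    set U : Finset (ι ⊕ ι) := Finset.univ with hU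
    set u : ι ⊕ ι := Sum.inl e.1
    set v : ι ⊕ ι := Sum.inr e.2
    have huv : u ≠ v := hne e
    have hcorr : F (U.erase u) * F (U.erase v) ≤ F U * F ((U.erase u).erase v) :=
      (matchSum_correlation isLeft_inl_ne_isLeft_inr hw l _ U rfl u (by simp [hU]) v (by simp [hU])
        huv).2 (isLeft_inl_ne_isLeft_inr e)
    -- The new matching sum is `a + d` for the bilinear polynomial in `(y e, z e)` whose
    -- coefficients are supplied to `mul_rpow_le_add` below.
    have hstep : bipartiteMatchSum w r (e :: l) U =
        F U + w e * F ((U.erase u).erase v) := by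
      simp [bipartiteMatchSum, matchSum, hU, hF, u, v]
    rw [hstep, List.toFinset_cons, Finset.prod_insert hel]
    have hmain := mul_rpow_le_add (a := F U) (b := w e * F (U.erase u)) (c := F (U.erase v))
      (d := w e * F ((U.erase u).erase v)) (α := α e)
      (K := K * (∏ e ∈ l.toFinset, (α e ^ α e * (1 - α e) ^ (1 - α e))) *
          ∏ e ∈ S, (y e * z e) ^ α e) (hF0 _) (mul_nonneg (hw e) (hF0 _)) (hF0 _)
      (mul_nonneg (hw e) (hF0 _)) (by nlinarith [mul_le_mul_of_nonneg_left hcorr (hw e)])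
      (hα e) (hα' e) ?_
    · refine le_trans (le_of_eq ?_) hmain
      ring
    -- Use the induction hypothesis with `y e`, `z e` replaced by free `s`, `t`. As `e ∉ S`, the
    -- remaining product and the vertex weights from `S` are unaffected.
    · intro s t hs ht
      have hys : ∀ e', 0 < Function.update y e s e' := fun e' => by
        rw [Function.update_apply]; split_ifs; exacts [hs, hy e']
      have hzt : ∀ e', 0 < Function.update z e t e' := fun e' => by
        rw [Function.update_apply]; split_ifs; exacts [ht, hz e']
      have h := ih (List.nodup_cons.1 hl).2 _ _ hys hzt
      have hupd : ∀ (p : ι × ι → ℝ) (q : ℝ), ∀ e' ∈ S, Function.update p e q e' = p e' :=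
        fun p q e' he' => Function.update_of_ne (by rintro rfl; exact heS he') _ _
      have hvw : vertexWeight S (fun e' => w e' * Function.update y e s e')
          (Function.update z e t) = r :=
        vertexWeight_congr (fun e' he' => by rw [hupd y s e' he']) (hupd z t)
      rw [hlS, Finset.prod_insert heS, vertexWeight_insert heS, hvw] at h
      have hprod : ∏ e' ∈ S, (Function.update y e s e' * Function.update z e t e') ^ α e' =
          ∏ e' ∈ S, (y e' * z e') ^ α e' :=
        Finset.prod_congr rfl fun e' he' => by rw [hupd y s e' he', hupd z t e' he']
      rw [hprod] at h
      simp only [Function.update_self] at h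
      -- The outer update must start from the value of the already updated function for
      -- `matchSum_update_add` to match; the endpoints differ, so that value is unchanged.
      have hrv : r (Sum.inr e.2) =
          Function.update r u (r (Sum.inl e.1) + w e * s) (Sum.inr e.2) := by
        rw [Function.update_of_ne huv.symm]
      rw [hrv, bipartiteMatchSum, matchSum_update_add hne l (by simp [hU]),
        matchSum_update_add hne l (by simp [hU]), matchSum_update_add hne l (by simp [hU])] at h
      rw [Finset.erase_right_comm (a := Sum.inr e.2)] at h
      change _ ≤ F U + w e * s * F (U.erase u) +
        t * (F (U.erase v) + w e * s * F ((U.erase u).erase v)) at h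
      linarith

-- Weighted AM-GM with weights `A i j`: in each row for the numbers `(1 - A i j) * y (i, j)`, in
-- each column for `z (i, j) / A i j`. Row and column sums equal to `1` make the weights admissible.
open Real in
theorem prod_rpow_le_prod_sum {A : Matrix ι ι ℝ} (hA : A ∈ doublyStochastic ℝ ι)
    {y z : ι × ι → ℝ} (hy : ∀ e, 0 < y e) (hz : ∀ e, 0 < z e) :
    (∏ e : ι × ι, ((1 - A e.1 e.2) / A e.1 e.2) ^ A e.1 e.2) *
        ∏ e : ι × ι, (y e * z e) ^ A e.1 e.2 ≤
      ∏ v, vertexWeight Finset.univ (fun e => A e.1 e.2 * (1 - A e.1 e.2) * y e) z v := by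
  have h0 : ∀ i j, 0 ≤ A i j := fun i j => nonneg_of_mem_doublyStochastic hA
  have h1 : ∀ i j, 0 ≤ 1 - A i j := fun i j =>
    sub_nonneg.2 (le_one_of_mem_doublyStochastic hA)
  have hrow : ∀ i, ∏ j, ((1 - A i j) * y (i, j)) ^ A i j ≤
      ∑ e : ι × ι with e.1 = i, A e.1 e.2 * (1 - A e.1 e.2) * y e := by
    intro i
    refine (geom_mean_le_arith_mean_weighted _ (fun j => A i j) _ (fun j _ => h0 i j)
      (sum_row_of_mem_doublyStochastic hA i)
      fun j _ => mul_nonneg (h1 i j) (hy _).le).trans (le_of_eq ?_)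
    rw [Finset.sum_filter, Fintype.sum_prod_type_right]
    simp [mul_assoc]
  have hcol : ∀ j, ∏ i, (z (i, j) / A i j) ^ A i j ≤ ∑ e : ι × ι with e.2 = j, z e := by
    intro j
    refine (geom_mean_le_arith_mean_weighted _ (fun i => A i j) _ (fun i _ => h0 i j)
      (sum_col_of_mem_doublyStochastic hA j)
      fun i _ => div_nonneg (hz _).le (h0 i j)).trans ?_
    rw [Finset.sum_filter, Fintype.sum_prod_type]
    simp only [Finset.sum_ite_eq', Finset.mem_univ, if_true]
    refine Finset.sum_le_sum fun i _ => ?_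
    -- At a zero entry the quotient is `0` by convention and the weight is `0`, so the term only has
    -- to be at most `z (i, j)`.
    rcases (h0 i j).eq_or_lt with h | h
    · rw [← h]; simpa using (hz _).le
    · rw [mul_div_cancel₀ _ h.ne']
  rw [Fintype.prod_sum_type]
  refine le_trans (le_of_eq ?_) (mul_le_mul
    (Finset.prod_le_prod (fun i _ => Finset.prod_nonneg fun j _ =>
      rpow_nonneg (mul_nonneg (h1 i j) (hy _).le) _) fun i _ => hrow i)
    (Finset.prod_le_prod (fun j _ => Finset.prod_nonneg fun i _ =>
      rpow_nonneg (div_nonneg (hz _).le (h0 i j)) _) fun j _ => hcol j)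
    (Finset.prod_nonneg fun j _ => Finset.prod_nonneg fun i _ =>
      rpow_nonneg (div_nonneg (hz _).le (h0 i j)) _)
    (Finset.prod_nonneg fun i _ => Finset.sum_nonneg fun e _ =>
      mul_nonneg (mul_nonneg (h0 _ _) (h1 _ _)) (hy e).le))
  rw [Finset.prod_comm (s := Finset.univ (α := ι)) (f := fun j i => (z (i, j) / A i j) ^ A i j),
    Fintype.prod_prod_type, Fintype.prod_prod_type, ← Finset.prod_mul_distrib,
    ← Finset.prod_mul_distrib]
  refine Finset.prod_congr rfl fun i _ => ?_
  rw [← Finset.prod_mul_distrib, ← Finset.prod_mul_distrib]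
  refine Finset.prod_congr rfl fun j _ => ?_
  rw [← mul_rpow (div_nonneg (h1 i j) (h0 i j)) (mul_pos (hy _) (hz _)).le,
    ← mul_rpow (mul_nonneg (h1 i j) (hy _).le) (div_nonneg (hz _).le (h0 i j))]
  congr 1
  ring

-- The AM-GM constant of one entry times the cost of processing its edge. At `a = 0` the conventions
-- `x / 0 = 0` and `0 ^ 0 = 1` give the right value.
open Real in
theorem div_rpow_mul_rpow_mul_rpow {a : ℝ} (h0 : 0 ≤ a) (h1 : a ≤ 1) :
    ((1 - a) / a) ^ a * (a ^ a * (1 - a) ^ (1 - a)) = 1 - a := by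
  have hb : 0 ≤ 1 - a := sub_nonneg.2 h1
  rw [← mul_assoc, ← mul_rpow (div_nonneg hb h0) h0]
  rcases h0.eq_or_lt with rfl | h
  · simp
  · rw [div_mul_cancel₀ _ h.ne', ← rpow_add' hb (by simp), add_sub_cancel, rpow_one]

end Schrijver

/-! ### Conclusion -/

theorem mainTheorem6 (n : ℕ) (A : Matrix (Fin n) (Fin n) ℝ)
    (hA : A ∈ doublyStochastic ℝ (Fin n)) :
    (tildeMatrix A).permanent ≥ ∏ i : Fin n, ∏ j : Fin n, (1 - A i j) := by
  have h0 : ∀ i j, 0 ≤ A i j := fun i j => nonneg_of_mem_doublyStochastic hA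
  have h1 : ∀ i j, A i j ≤ 1 := fun i j => le_one_of_mem_doublyStochastic hA
  have h := capacity_le_bipartiteMatchSum
    (w := fun e : Fin n × Fin n => A e.1 e.2 * (1 - A e.1 e.2)) (α := fun e => A e.1 e.2)
    (fun e => mul_nonneg (h0 _ _) (sub_nonneg.2 (h1 _ _))) (fun e => h0 _ _) (fun e => h1 _ _)
    (fun y z hy hz => prod_rpow_le_prod_sum hA hy hz) Finset.univ.toList (Finset.nodup_toList _)
    1 1 (fun _ => one_pos) (fun _ => one_pos)
  -- No unprocessed edge is left, so the vertex weights are zero and the choice `y = z = 1` is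
  -- immaterial.
  have hv : vertexWeight (∅ : Finset (Fin n × Fin n))
      (fun e => A e.1 e.2 * (1 - A e.1 e.2) * (1 : Fin n × Fin n → ℝ) e) 1 = 0 := by
    ext (a | a) <;> simp [vertexWeight]
  rw [Finset.toList_toFinset, Finset.compl_univ, hv, Finset.prod_empty, mul_one,
    ← Finset.prod_mul_distrib] at h
  rw [permanent_eq_bipartiteMatchSum]
  refine le_trans (le_of_eq ?_) h
  rw [Fintype.prod_prod_type]
  exact Finset.prod_congr rfl fun i _ => Finset.prod_congr rfl fun j _ =>
    (div_rpow_mul_rpow_mul_rpow (h0 i j) (h1 i j)).symm
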